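/- Let $V$ be a finite set and let $\Pi$ be a partition of $V$ into non-empty blocks; write $i\sim_\Pi j$ if $i$ and $j$ lie in the same block. For a directed acyclic graph (DAG) $G=(V,E)$, let $M_{G,\Pi}$ be the set of all covariance matrices $$(I-\Lambda)^{-T}\,\mathrm{diag}(\omega)\,(I-\Lambda)^{-1},$$ where $\Lambda\in\mathbb{R}^{V\times V}$ satisfies $\lambda_{ij}=0$ whenever $i\to j$ is not an edge of $G$, and $\omega\in(0,\infty)^V$ satisfies $\omega_i=\omega_j$ whenever $i\sim_\Pi j$. (The partially homoscedastic linear Gaussian model of $(G,\Pi)$ consists of the multivariate normal distributions on $\mathbb{R}^V$ with covariance matrix in $M_{G,\Pi}$.) The skeleton of $G$ is the undirected graph obtained by forgetting the directions of the edges, and an unshielded collider of $G$ is a triple $(i,j,k)$ of vertices with $i\neq k$ and $i\to j\leftarrow k$ in $G$ such that there is no edge between $i$ and $k$ in either direction. Write $\mathrm{pa}_G(i)=\{j\in V: j\to i \text{ in } G\}$. Theorem. Let $G_1=(V,E_1)$ and $G_2=(V,E_2)$ be two DAGs. Then $M_{G_1,\Pi}=M_{G_2,\Pi}$ if and only if the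 following two conditions both hold: (i) $G_1$ and $G_2$ have the same skeleton and the same unshielded colliders; and (ii) $\mathrm{pa}_{G_1}(i)=\mathrm{pa}_{G_2}(i)$ for every $i\in V$ that belongs to a block of $\Pi$ of size at least $2$. -/

import Mathlib

open scoped Matrix

namespace PartialHomoscedastic

section Graph

variable {V : Type*}

/-- A directed graph is acyclic if no vertex lies on a directed cycle (in particular, there are no
self-loops). `G.Adj i j` is the edge `i → j`. -/
def IsDAG (G : Digraph V) : Prop :=
  ∀ i, ¬ Relation.TransGen G.Adj i i

/-- The set of parents of `i` in `G`. -/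
def parents (G : Digraph V) (i : V) : Set V :=
  {j | G.Adj j i}

/-- The skeleton of `G`: the undirected graph joining two distinct vertices whenever `G` has an
edge between them, in either direction. -/
def skeleton (G : Digraph V) : SimpleGraph V :=
  G.toSimpleGraphInclusive

/-- The set of unshielded collider triples `(i, j, k)` of `G`: `i → j ← k` with `i ≠ k`, and no
edge between `i` and `k`. -/
def unshieldedColliders (G : Digraph V) : Set (V × V × V) :=
  {t | G.Adj t.1 t.2.1 ∧ G.Adj t.2.2 t.2.1 ∧ t.1 ≠ t.2.2 ∧
    ¬ G.Adj t.1 t.2.2 ∧ ¬ G.Adj t.2.2 t.1}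

/-- The real `V × V` coefficient matrices supported on the edges of `G`. -/
def coeffMatrices (G : Digraph V) : Set (Matrix V V ℝ) :=
  {Λ | ∀ i j, ¬ G.Adj i j → Λ i j = 0}

end Graph

section Model

variable {V : Type*} [Fintype V] [DecidableEq V]

/-- Two vertices are equivalent under a partition if they lie in a common block. -/
def SameBlock (P : Finpartition (Finset.univ : Finset V)) (i j : V) : Prop :=
  ∃ B ∈ P.parts, i ∈ B ∧ j ∈ B

/-- The covariance matrix `(I - Λ)⁻ᵀ diag(ω) (I - Λ)⁻¹` of the solution of `X = Λᵀ X + ε`, where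
the errors `ε` are independent with variances `ω`. If `Λ` is supported on the edges of an acyclic
graph then `I - Λ` is invertible. -/
noncomputable def covMatrix (Λ : Matrix V V ℝ) (ω : V → ℝ) : Matrix V V ℝ :=
  ((1 - Λ)⁻¹)ᵀ * Matrix.diagonal ω * (1 - Λ)⁻¹

/-- The partially homoscedastic linear Gaussian model of `(G, P)`, as a set of covariance
matrices. -/
def model (G : Digraph V) (P : Finpartition (Finset.univ : Finset V)) : Set (Matrix V V ℝ) :=
  {S | ∃ Λ ∈ coeffMatrices G, ∃ ω : V → ℝ,
    (∀ i, 0 < ω i) ∧ (∀ i j, SameBlock P i j → ω i = ω j) ∧ S = covMatrix Λ ω}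

/-- Model equivalence of two directed graphs with respect to a partition. -/
def ModelEquivalent (P : Finpartition (Finset.univ : Finset V)) (G₁ G₂ : Digraph V) : Prop :=
  model G₁ P = model G₂ P

end Model

end PartialHomoscedastic

namespace PartialHomoscedastic

/-! ### Acyclic directed graphs and rank functions -/

section Acyclic

variable {V : Type*}

/-! Sufficiency: condition (i) makes the DAGs Markov equivalent, so they are joined by covered edge
reversals, each of which keeps the model with unrestricted variances
(`MarkovEquivalent.exists_covMatrix_eq`). The error variance of a vertex is its residual variance
after regression on its parents, so it depends only on the covariance matrix and the parent set
(`errorVariance_unique`). By (ii) it is unchanged on blocks of size at least 2, and the equality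
constraints survive.

Necessity: one or two unit coefficients with unit error variances, which respect every partition,
give test covariances. They detect adjacencies, unshielded colliders and the parents of vertices in
large blocks (`adj_or_of_model_subset`, `collider_of_model_subset`, `adj_of_model_subset`). -/

theorem IsDAG.irrefl {G : Digraph V} (hG : IsDAG G) (i : V) : ¬ G.Adj i i :=
  fun h => hG i (.single h)

theorem IsDAG.asymm {G : Digraph V} (hG : IsDAG G) {i j : V} (h : G.Adj i j) : ¬ G.Adj j i :=
  fun h' => hG i (.tail (.single h) h')

/-- A directed graph with a strictly increasing rank function is acyclic. -/
theorem isDAG_of_rank {G : Digraph V} (r : V → ℕ) (hr : ∀ a b, G.Adj a b → r a < r b) :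
    IsDAG G := by
  have key : ∀ a b, Relation.TransGen G.Adj a b → r a < r b := by
    intro a b h
    induction h with
    | single h => exact hr _ _ h
    | tail _ h ih => exact ih.trans (hr _ _ h)
  exact fun i h => lt_irrefl _ (key i i h)

/-- A finite acyclic directed graph has a strictly increasing rank function. -/
theorem IsDAG.exists_rank [Finite V] {G : Digraph V} (hG : IsDAG G) :
    ∃ r : V → ℕ, ∀ a b, G.Adj a b → r a < r b := by
  refine ⟨fun v => {u | Relation.TransGen G.Adj u v}.ncard, fun a b hab => ?_⟩
  refine Set.ncard_lt_ncard ⟨fun u hu => Relation.TransGen.tail hu hab, fun h => ?_⟩ (Set.toFinite _)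
  exact hG a (h (Relation.TransGen.single hab))

theorem skeleton_eq_iff {G H : Digraph V} (hG : IsDAG G) (hH : IsDAG H) :
    skeleton G = skeleton H ↔ ∀ a b, (G.Adj a b ∨ G.Adj b a) ↔ (H.Adj a b ∨ H.Adj b a) := by
  constructor
  · intro h a b
    have h' : (skeleton G).Adj a b ↔ (skeleton H).Adj a b := by rw [h]
    simp only [skeleton, Digraph.toSimpleGraphInclusive, SimpleGraph.fromRel_adj] at h'
    rcases eq_or_ne a b with rfl | hab
    · simp [hG.irrefl, hH.irrefl]
    · simpa [hab] using h'
  · intro h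
    ext a b
    simp only [skeleton, Digraph.toSimpleGraphInclusive, SimpleGraph.fromRel_adj, h]

end Acyclic

/-! ### Covered edges and Markov equivalence -/

section Covered

variable {V : Type*}

/-- An edge `x → y` is covered if the parents of `y` are `x` and the parents of `x`. -/
def IsCovered (G : Digraph V) (x y : V) : Prop :=
  G.Adj x y ∧ ∀ z, z ≠ x → (G.Adj z y ↔ G.Adj z x)

/-- The directed graph obtained by reversing the edge `x → y`. -/
def reverseEdge (G : Digraph V) (x y : V) : Digraph V where
  Adj a b := (a = y ∧ b = x) ∨ (G.Adj a b ∧ ¬ (a = x ∧ b = y))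

/-- Reversing a covered edge preserves acyclicity. -/
theorem IsCovered.isDAG_reverseEdge [Finite V] {G : Digraph V} (hG : IsDAG G) {x y : V}
    (h : IsCovered G x y) : IsDAG (reverseEdge G x y) := by
  classical
  obtain ⟨r, hr⟩ := hG.exists_rank
  have hxy := hr _ _ h.1
  -- Doubling the ranks makes room to move `y` to just below `x`; every other parent of `y` is a
  -- parent of `x`, hence still lower.
  refine isDAG_of_rank (fun v => if v = y then 2 * r x else 2 * r v + 1) ?_
  rintro a b (⟨rfl, rfl⟩ | ⟨hab, hne⟩)
  · have : b ≠ a := fun e => hG.irrefl a (e ▸ h.1)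
    simp [this]
  · have hab' := hr _ _ hab
    by_cases hb : b = y
    · subst hb
      have hax : a ≠ x := fun e => hne ⟨e, rfl⟩
      have hay : a ≠ b := fun e => hG.irrefl a (e ▸ hab)
      have := hr _ _ ((h.2 a hax).1 hab)
      simp only [hay, if_false, if_true]
      omega
    · by_cases ha : a = y
      · subst ha
        simp only [hb, if_false, if_true]
        omega
      · simp only [ha, hb, if_false]
        omega

theorem reverseEdge_adj_or {G : Digraph V} {x y : V} (h : G.Adj x y) (a b : V) :
    ((reverseEdge G x y).Adj a b ∨ (reverseEdge G x y).Adj b a) ↔ (G.Adj a b ∨ G.Adj b a) := by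
  simp only [reverseEdge]
  grind

/-- Reversing a covered edge preserves the unshielded colliders. -/
theorem IsCovered.reverseEdge_collider {G : Digraph V} (hG : IsDAG G) {x y : V}
    (h : IsCovered G x y) {a b c : V} (hac : a ≠ c) (h₁ : ¬ G.Adj a c) (h₂ : ¬ G.Adj c a) :
    ((reverseEdge G x y).Adj a b ∧ (reverseEdge G x y).Adj c b) ↔ (G.Adj a b ∧ G.Adj c b) := by
  obtain ⟨h, h'⟩ := h
  have hxy : x ≠ y := fun e => hG.irrefl y (e ▸ h)
  have hyx := hG.asymm h
  have := h' a
  have := h' c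
  simp only [reverseEdge]
  grind

/-- Same adjacencies and same unshielded colliders. -/
def MarkovEquivalent (G H : Digraph V) : Prop :=
  (∀ a b, (G.Adj a b ∨ G.Adj b a) ↔ (H.Adj a b ∨ H.Adj b a)) ∧
    ∀ a b c, a ≠ c → ¬ G.Adj a c → ¬ G.Adj c a →
      ((G.Adj a b ∧ G.Adj c b) ↔ (H.Adj a b ∧ H.Adj c b))

theorem markovEquivalent_of_eq {G H : Digraph V} (hG : IsDAG G) (hH : IsDAG H)
    (hs : skeleton G = skeleton H) (hc : unshieldedColliders G = unshieldedColliders H) :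
    MarkovEquivalent G H := by
  have hs' := (skeleton_eq_iff hG hH).1 hs
  refine ⟨hs', fun a b c hac h₁ h₂ => ?_⟩
  have h := Set.ext_iff.1 hc (a, b, c)
  have := hs' a c
  simp only [unshieldedColliders, Set.mem_ofPred_eq] at h
  tauto

theorem MarkovEquivalent.reverseEdge {G H : Digraph V} (hG : IsDAG G) (e : MarkovEquivalent G H)
    {x y : V} (h : IsCovered G x y) : MarkovEquivalent (reverseEdge G x y) H := by
  refine ⟨fun a b => (reverseEdge_adj_or h.1 a b).trans (e.1 a b), fun a b c hac h₁ h₂ => ?_⟩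
  have := reverseEdge_adj_or h.1 a c
  have h₁' : ¬ G.Adj a c := by tauto
  have h₂' : ¬ G.Adj c a := by tauto
  exact (h.reverseEdge_collider hG hac h₁' h₂').trans (e.2 a b c hac h₁' h₂')

/-- If two Markov equivalent DAGs disagree on the direction of some edge, then they disagree on the
direction of an edge that is covered in the first one. -/
theorem MarkovEquivalent.exists_isCovered [Finite V] {G H : Digraph V} (hG : IsDAG G)
    (hH : IsDAG H) (e : MarkovEquivalent G H) (hd : ∃ x y, G.Adj x y ∧ H.Adj y x) :
    ∃ x y, IsCovered G x y ∧ H.Adj y x := by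
  classical
  obtain ⟨r, hr⟩ := hG.exists_rank
  -- Take the lowest head `y` of a disagreeing edge, then its highest disagreeing tail `x`. Any
  -- failure of coveredness gives a cycle, a mismatched collider or a better choice.
  obtain ⟨y, ⟨x₀, hx₀⟩, hmin⟩ := Set.exists_min_image {y | ∃ x, G.Adj x y ∧ H.Adj y x} r
    (Set.toFinite _) (by obtain ⟨x, y, h⟩ := hd; exact ⟨y, x, h⟩)
  obtain ⟨x, ⟨hxy, hyx⟩, hmax⟩ := Set.exists_max_image {x | G.Adj x y ∧ H.Adj y x} r
    (Set.toFinite _) ⟨x₀, hx₀⟩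
  have hkeep : ∀ a b, r b < r y → G.Adj a b → H.Adj a b := by
    intro a b hb hab
    rcases (e.1 a b).1 (Or.inl hab) with h | h
    · exact h
    · exact absurd (hmin b ⟨a, hab, h⟩) (not_le.2 hb)
  have hH3 : ∀ {a b c}, H.Adj a b → H.Adj b c → ¬ H.Adj c a := fun h₁ h₂ h₃ =>
    hH _ (((Relation.TransGen.single h₁).tail h₂).tail h₃)
  have hG3 : ∀ {a b c}, G.Adj a b → G.Adj b c → ¬ G.Adj c a := fun h₁ h₂ h₃ =>
    hG _ (((Relation.TransGen.single h₁).tail h₂).tail h₃)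
  refine ⟨x, y, ⟨hxy, fun z hz => ⟨fun hzy => ?_, fun hzx => ?_⟩⟩, hyx⟩
  · by_contra hzx
    by_cases hxz : G.Adj x z
    · have hxz' := hkeep x z (hr _ _ hzy) hxz
      rcases (e.1 z y).1 (Or.inl hzy) with h | h
      · exact hH3 hxz' h hyx
      · exact absurd (hmax z ⟨hzy, h⟩) (not_le.2 (hr _ _ hxz))
    · have := ((e.2 z y x hz hzx hxz).1 ⟨hzy, hxy⟩).2
      exact hH.asymm this hyx
  · have hzx' := hkeep z x (hr _ _ hxy) hzx
    have hyz : ¬ G.Adj y z := hG3 hzx hxy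
    by_contra hzy
    have hne : z ≠ y := fun h => hG.asymm hxy (h ▸ hzx)
    have := ((e.2 z x y hne hzy hyz).2 ⟨hzx', hyx⟩).2
    exact hG.asymm this hxy

/-- A property of DAGs that is stable under reversal of covered edges is stable under Markov
equivalence. -/
theorem MarkovEquivalent.induction [Finite V] {p : Digraph V → Prop}
    (hp : ∀ G x y, IsDAG G → IsCovered G x y → p G → p (PartialHomoscedastic.reverseEdge G x y))
    {G H : Digraph V}
    (hG : IsDAG G) (hH : IsDAG H) (e : MarkovEquivalent G H) (h : p G) : p H := by
  classical
  -- Each reversal strictly decreases the number of edges oriented oppositely in `G` and `H`.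
  generalize hn : {t : V × V | G.Adj t.1 t.2 ∧ H.Adj t.2 t.1}.ncard = n
  induction n using Nat.strong_induction_on generalizing G with
  | _ n ih =>
    by_cases hd : ∃ x y, G.Adj x y ∧ H.Adj y x
    · obtain ⟨x, y, hc, hyx⟩ := e.exists_isCovered hG hH hd
      refine ih _ ?_ (hc.isDAG_reverseEdge hG) (e.reverseEdge hG hc) (hp G x y hG hc h) rfl
      rw [← hn]
      refine Set.ncard_lt_ncard ⟨?_, fun hsub => ?_⟩ (Set.toFinite _)
      · rintro ⟨a, b⟩ ⟨⟨h₁, h₂⟩ | ⟨h₁, -⟩, h₃⟩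
        · simp only at h₁ h₂ h₃
          subst h₁ h₂
          exact absurd h₃ (hH.asymm hyx)
        · exact ⟨h₁, h₃⟩
      · have hxy : x ≠ y := fun h => hH.irrefl x (h ▸ hyx)
        rcases (hsub (show (x, y) ∈ _ from ⟨hc.1, hyx⟩)).1 with h | h
        · exact hxy h.1
        · exact h.2 ⟨rfl, rfl⟩
    · have : G = H := by
        ext a b
        have := e.1 a b
        have h₁ : ¬ (G.Adj a b ∧ H.Adj b a) := fun h => hd ⟨_, _, h⟩
        have h₂ : ¬ (G.Adj b a ∧ H.Adj a b) := fun h => hd ⟨_, _, h⟩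
        have h₃ : G.Adj a b → ¬ G.Adj b a := hG.asymm
        have h₄ : H.Adj a b → ¬ H.Adj b a := hH.asymm
        tauto
      exact this ▸ h

end Covered

/-! ### Path coefficients, regression and precision matrices -/

section Linear

variable {V : Type*} [Fintype V] [DecidableEq V] {G : Digraph V} {Λ : Matrix V V ℝ} {ω : V → ℝ}

/-- The coefficient matrix of a DAG has an invertible complement. -/
theorem isUnit_det_one_sub (hG : IsDAG G) (hΛ : Λ ∈ coeffMatrices G) : IsUnit (1 - Λ).det := by
  obtain ⟨r, hr⟩ := hG.exists_rank
  have hinj : Function.Injective (1 - Λ).vecMul := by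
    rw [← Matrix.coe_vecMulLinear, injective_iff_map_eq_zero]
    intro v hv
    have hv' : ∀ j, v j = ∑ i, v i * Λ i j := by
      intro j
      have := congrFun hv j
      simp only [Matrix.coe_vecMulLinear, Matrix.vecMul_sub, Matrix.vecMul_one, Pi.sub_apply,
        Pi.zero_apply, sub_eq_zero] at this
      simpa [Matrix.vecMul, dotProduct] using this
    have key : ∀ n j, r j = n → v j = 0 := by
      intro n
      induction n using Nat.strong_induction_on with
      | _ n ih =>
        intro j hj
        rw [hv' j]
        refine Finset.sum_eq_zero fun i _ => ?_
        by_cases hij : G.Adj i j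
        · rw [ih (r i) (hj ▸ hr _ _ hij) i rfl, zero_mul]
        · rw [hΛ i j hij, mul_zero]
    exact funext fun j => key _ j rfl
  rwa [← Matrix.isUnit_iff_isUnit_det, ← Matrix.vecMul_injective_iff_isUnit]

theorem inv_eq_one_add (hG : IsDAG G) (hΛ : Λ ∈ coeffMatrices G) (i j : V) :
    (1 - Λ)⁻¹ i j = (1 : Matrix V V ℝ) i j + ∑ k, (1 - Λ)⁻¹ i k * Λ k j := by
  have h := Matrix.nonsing_inv_mul (1 - Λ) (isUnit_det_one_sub hG hΛ)
  rw [mul_sub, mul_one, sub_eq_iff_eq_add] at h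
  rw [← Matrix.mul_apply, ← Matrix.add_apply, ← h]

theorem inv_eq_zero (hG : IsDAG G) (hΛ : Λ ∈ coeffMatrices G) (i j : V) (hij : i ≠ j)
    (h : ¬ Relation.TransGen G.Adj i j) : (1 - Λ)⁻¹ i j = 0 := by
  obtain ⟨r, hr⟩ := hG.exists_rank
  induction hn : r j using Nat.strong_induction_on generalizing j with
  | _ n ih =>
    rw [inv_eq_one_add hG hΛ, Matrix.one_apply_ne hij, zero_add]
    refine Finset.sum_eq_zero fun k _ => ?_
    by_cases hkj : G.Adj k j
    · have hik : i ≠ k := fun e => h (.single (e ▸ hkj))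
      rw [ih (r k) (hn ▸ hr _ _ hkj) k hik (fun h' => h (h'.tail hkj)) rfl, zero_mul]
    · rw [hΛ k j hkj, mul_zero]

theorem inv_diag (hG : IsDAG G) (hΛ : Λ ∈ coeffMatrices G) (i : V) : (1 - Λ)⁻¹ i i = 1 := by
  rw [inv_eq_one_add hG hΛ, Matrix.one_apply_eq, add_eq_left]
  refine Finset.sum_eq_zero fun k _ => ?_
  by_cases hki : G.Adj k i
  · have hik : i ≠ k := fun e => hG.irrefl i (e ▸ hki)
    rw [inv_eq_zero hG hΛ i k hik (fun h => hG i (h.tail hki)), zero_mul]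
  · rw [hΛ k i hki, mul_zero]

theorem covMatrix_mul (hG : IsDAG G) (hΛ : Λ ∈ coeffMatrices G) (i j : V) :
    (covMatrix Λ ω * (1 - Λ)) i j = (1 - Λ)⁻¹ j i * ω j := by
  rw [covMatrix, mul_assoc, Matrix.nonsing_inv_mul _ (isUnit_det_one_sub hG hΛ), mul_one,
    Matrix.mul_diagonal, Matrix.transpose_apply]

/-- The residual of a vertex is uncorrelated with its parents. -/
theorem covMatrix_mul_parent (hG : IsDAG G) (hΛ : Λ ∈ coeffMatrices G) {i j : V}
    (h : G.Adj i j) : (covMatrix Λ ω * (1 - Λ)) i j = 0 := by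
  have hne : j ≠ i := fun e => hG.irrefl i (e ▸ h)
  rw [covMatrix_mul hG hΛ, inv_eq_zero hG hΛ j i hne (fun h' => hG j (h'.tail h)), zero_mul]

theorem covMatrix_mul_self (hG : IsDAG G) (hΛ : Λ ∈ coeffMatrices G) (i : V) :
    (covMatrix Λ ω * (1 - Λ)) i i = ω i := by
  rw [covMatrix_mul hG hΛ, inv_diag hG hΛ, one_mul]

theorem posDef_covMatrix (hG : IsDAG G) (hΛ : Λ ∈ coeffMatrices G) (hω : ∀ i, 0 < ω i) :
    (covMatrix Λ ω).PosDef := by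
  have hu := (Matrix.isUnit_nonsing_inv_det _ (isUnit_det_one_sub hG hΛ))
  have := (Matrix.PosDef.diagonal hω).conjTranspose_mul_mul_same (B := (1 - Λ)⁻¹)
    (Matrix.mulVec_injective_iff_isUnit.2 ((Matrix.isUnit_iff_isUnit_det _).2 hu))
  simpa [covMatrix, Matrix.conjTranspose_eq_transpose_of_trivial] using this

/-- The error variance is at most the variance. -/
theorem le_covMatrix_self (hG : IsDAG G) (hΛ : Λ ∈ coeffMatrices G) (hω : ∀ i, 0 < ω i) (i : V) :
    ω i ≤ covMatrix Λ ω i i := by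
  have : covMatrix Λ ω i i = ∑ k, ω k * (1 - Λ)⁻¹ k i ^ 2 := by
    rw [covMatrix, Matrix.mul_apply]
    refine Finset.sum_congr rfl fun k _ => ?_
    rw [Matrix.mul_diagonal, Matrix.transpose_apply]
    ring
  rw [this]
  have h := Finset.single_le_sum (f := fun k => ω k * (1 - Λ)⁻¹ k i ^ 2)
    (fun k _ => mul_nonneg (hω k).le (sq_nonneg _)) (Finset.mem_univ i)
  simpa [inv_diag hG hΛ] using h

omit [DecidableEq V] in
/-- Uniqueness of regression coefficients. -/
theorem regression_unique {S : Matrix V V ℝ} (hS : S.PosDef) (A : Set V) {u v : V → ℝ}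
    (huv : ∀ j ∉ A, u j = v j) (hu : ∀ j ∈ A, (S *ᵥ u) j = 0) (hv : ∀ j ∈ A, (S *ᵥ v) j = 0) :
    u = v := by
  by_contra hne
  have hpos := hS.dotProduct_mulVec_pos (sub_ne_zero.2 hne)
  refine hpos.ne' ?_
  refine Finset.sum_eq_zero fun j _ => ?_
  by_cases hj : j ∈ A
  · simp [Matrix.mulVec_sub, hu j hj, hv j hj]
  · simp [huv j hj]

/-- A column of the coefficient matrix and the corresponding error variance are determined by the
covariance matrix and the parents: any solution of the normal equations gives them. -/
theorem regression_eq (hG : IsDAG G) (hΛ : Λ ∈ coeffMatrices G) (hω : ∀ i, 0 < ω i) (i : V)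
    {u : V → ℝ} (hu : ∀ j, ¬ G.Adj j i → u j = (1 : Matrix V V ℝ) j i)
    (hn : ∀ j, G.Adj j i → (covMatrix Λ ω *ᵥ u) j = 0) :
    (∀ j, (1 - Λ) j i = u j) ∧ ω i = (covMatrix Λ ω *ᵥ u) i := by
  have h : (fun j => (1 - Λ) j i) = u := by
    refine regression_unique (posDef_covMatrix hG hΛ hω) {j | G.Adj j i} (fun j hj => ?_)
      (fun j hj => covMatrix_mul_parent hG hΛ hj) hn
    rw [hu j hj, Matrix.sub_apply, hΛ j i hj, sub_zero]
  exact ⟨congrFun h, by rw [← h]; exact (covMatrix_mul_self hG hΛ i).symm⟩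

/-- The error variance of a vertex is determined by the covariance matrix and the parents. -/
theorem errorVariance_unique {H : Digraph V} {Γ : Matrix V V ℝ} {ν : V → ℝ} (hG : IsDAG G)
    (hH : IsDAG H) (hΛ : Λ ∈ coeffMatrices G) (hΓ : Γ ∈ coeffMatrices H) (hω : ∀ i, 0 < ω i)
    (h : covMatrix Λ ω = covMatrix Γ ν) {i : V} (hp : parents G i = parents H i) :
    ω i = ν i := by
  have hp' : ∀ j, G.Adj j i ↔ H.Adj j i := Set.ext_iff.1 hp
  rw [(regression_eq hG hΛ hω i (u := fun j => (1 - Γ) j i) (fun j hj => ?_) fun j hj => ?_).2, h]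
  · exact covMatrix_mul_self hH hΓ i
  · rw [Matrix.sub_apply, hΓ j i (mt (hp' j).2 hj), sub_zero]
  · rw [h]
    exact covMatrix_mul_parent hH hΓ ((hp' j).1 hj)

/-- A vertex uncorrelated with its parents has zero coefficients, and its error variance is its
variance. -/
theorem coeff_eq_zero_of_uncorrelated (hG : IsDAG G) (hΛ : Λ ∈ coeffMatrices G)
    (hω : ∀ i, 0 < ω i) {i : V} (h : ∀ j, G.Adj j i → covMatrix Λ ω j i = 0) :
    (∀ j, Λ j i = 0) ∧ ω i = covMatrix Λ ω i i := by
  have := regression_eq hG hΛ hω i (u := Pi.single i 1)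
    (fun j _ => by simp [Matrix.one_apply, Pi.single_apply])
    (fun j hj => by simpa using h j hj)
  refine ⟨fun j => ?_, by simpa using this.2⟩
  have hj := this.1 j
  simpa [Matrix.one_apply, Pi.single_apply] using hj

/-- The precision matrix `(I - Λ) diag(ω)⁻¹ (I - Λ)ᵀ`. -/
noncomputable def precMatrix (Λ : Matrix V V ℝ) (ω : V → ℝ) : Matrix V V ℝ :=
  (1 - Λ) * Matrix.diagonal (fun i => (ω i)⁻¹) * (1 - Λ)ᵀ

theorem precMatrix_apply (Λ : Matrix V V ℝ) (ω : V → ℝ) (a b : V) :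
    precMatrix Λ ω a b = ∑ l, (1 - Λ) a l * (ω l)⁻¹ * (1 - Λ) b l := by
  rw [precMatrix, Matrix.mul_apply]
  refine Finset.sum_congr rfl fun l _ => ?_
  rw [Matrix.mul_diagonal, Matrix.transpose_apply]

theorem inv_precMatrix (hω : ∀ i, 0 < ω i) : (precMatrix Λ ω)⁻¹ = covMatrix Λ ω := by
  have hd : (Matrix.diagonal (fun i => (ω i)⁻¹))⁻¹ = Matrix.diagonal ω := by
    refine Matrix.inv_eq_right_inv ?_
    rw [Matrix.diagonal_mul_diagonal, ← Matrix.diagonal_one]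
    congr 1
    funext i
    exact inv_mul_cancel₀ (hω i).ne'
  rw [precMatrix, covMatrix, Matrix.mul_inv_rev, Matrix.mul_inv_rev, hd, Matrix.transpose_nonsing_inv,
    mul_assoc]

theorem inv_covMatrix (hG : IsDAG G) (hΛ : Λ ∈ coeffMatrices G) (hω : ∀ i, 0 < ω i) :
    (covMatrix Λ ω)⁻¹ = precMatrix Λ ω := by
  rw [← inv_precMatrix hω, Matrix.nonsing_inv_nonsing_inv]
  have hu := isUnit_det_one_sub hG hΛ
  rw [precMatrix, Matrix.det_mul, Matrix.det_mul, Matrix.det_transpose, Matrix.det_diagonal]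
  refine (hu.mul ?_).mul hu
  exact isUnit_iff_ne_zero.2 (Finset.prod_ne_zero_iff.2 fun i _ => inv_ne_zero (hω i).ne')

/-! ### Sufficiency: transfer along covered reversals -/

/-- Covered edge reversal does not change the heteroscedastic model. -/
theorem IsCovered.exists_covMatrix_eq (hG : IsDAG G) {x y : V} (h : IsCovered G x y)
    (hΛ : Λ ∈ coeffMatrices G) (hω : ∀ i, 0 < ω i) :
    ∃ Γ ∈ coeffMatrices (reverseEdge G x y), ∃ ν : V → ℝ,
      (∀ i, 0 < ν i) ∧ covMatrix Λ ω = covMatrix Γ ν := by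
  have hxy : x ≠ y := fun e => hG.irrefl y (e ▸ h.1)
  have hyx := hG.asymm h.1
  set a := Λ x y with ha
  have hα := hω y
  have hβ := hω x
  set α := ω y
  set β := ω x
  have hs : 0 < α + a ^ 2 * β := by positivity
  -- In terms of residuals: `p` is the new residual of `y`, and `q` the old residual of `x`.
  set q : V → ℝ := fun b => (1 - Λ) b x with hq
  set p : V → ℝ := fun b => (1 - Λ) b y + a * q b with hp
  -- Here `p` has variance `α + a ^ 2 * β` and covariance `a * β` with `q`, so `c` is the
  -- coefficient of `q` regressed on `p`.
  set c := a * β / (α + a ^ 2 * β) with hc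
  let U : Matrix V V ℝ := fun b l =>
    if l = y then p b else if l = x then q b - c * p b else (1 - Λ) b l
  let ν : V → ℝ := fun l =>
    if l = y then α + a ^ 2 * β else if l = x then α * β / (α + a ^ 2 * β) else ω l
  have hν : ∀ i, 0 < ν i := by
    intro i
    simp only [ν]
    split_ifs
    · exact hs
    · positivity
    · exact hω i
  refine ⟨1 - U, fun b l hbl => ?_, ν, hν, ?_⟩
  · have hq0 : ∀ b, b ≠ x → ¬ G.Adj b x → q b = 0 := fun b h₁ h₂ => by
      simp [hq, Matrix.one_apply_ne h₁, hΛ _ _ h₂]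
    have hp0 : ∀ b, b ≠ y → ¬ G.Adj b x → p b = 0 := fun b h₁ h₂ => by
      by_cases hbx : b = x
      · subst hbx
        simp [hp, hq, Matrix.one_apply_ne hxy, hΛ _ _ h₂, ha]
      · simp [hp, hq0 b hbx h₂, Matrix.one_apply_ne h₁, hΛ _ _ (mt (h.2 b hbx).1 h₂)]
    have hpy : p y = 1 := by
      simp [hp, hq0 y hxy.symm hyx, hΛ _ _ (hG.irrefl y)]
    have hqx : q x = 1 := by simp [hq, hΛ _ _ (hG.irrefl x)]
    have h₁ : b = y → l ≠ x := fun h₁ h₂ => hbl (Or.inl ⟨h₁, h₂⟩)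
    have h₂ : G.Adj b l → b = x ∧ l = y := fun h₁ => by_contra fun h₂ => hbl (Or.inr ⟨h₁, h₂⟩)
    rw [Matrix.sub_apply, sub_eq_zero]
    simp only [U]
    split_ifs with hly hlx
    · subst hly
      by_cases hb : b = l
      · rw [hb, hpy, Matrix.one_apply_eq]
      · rw [Matrix.one_apply_ne hb, hp0 b hb]
        intro hbx
        have hbne : b ≠ x := fun e => hG.irrefl x (e ▸ hbx)
        exact hbne (h₂ ((h.2 b hbne).2 hbx)).1
    · subst hlx
      have hbl : ¬ G.Adj b l := fun h' => hly (h₂ h').2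
      have hby : b ≠ y := fun e => h₁ e rfl
      rw [hp0 b hby hbl]
      by_cases hb : b = l
      · rw [hb, hqx, Matrix.one_apply_eq]; ring
      · rw [Matrix.one_apply_ne hb, hq0 b hb hbl]; ring
    · rw [Matrix.sub_apply, hΛ b l (fun h' => hly (h₂ h').2), sub_zero]
  -- Precision matrices need no inverse of `1 - Λ` and are sums over vertices, of which only the
  -- terms at `x` and `y` change.
  · rw [← inv_precMatrix hω, ← inv_precMatrix hν]
    congr 1
    ext b d
    rw [precMatrix_apply, precMatrix_apply, sub_sub_cancel, ← sub_eq_zero,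
      ← Finset.sum_sub_distrib, Fintype.sum_eq_add x y hxy]
    · have e₁ : ∀ b, (1 - Λ) b y = p b - a * q b := fun b => by simp [hp]
      have e₂ : ∀ b, (1 - Λ) b x = q b := fun b => rfl
      simp only [U, ν, hxy, if_true, if_false, e₁, e₂, hc]
      have hα' := hα.ne'
      have hβ' := hβ.ne'
      have hs' := hs.ne'
      change _ * β⁻¹ * _ - _ + (_ * α⁻¹ * _ - _) = 0
      generalize q b = qb, q d = qd, p b = pb, p d = pd at *
      field_simp
      ring
    · rintro l ⟨hlx, hly⟩
      simp [U, ν, hlx, hly]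

/-- Markov equivalent DAGs have the same heteroscedastic model. -/
theorem MarkovEquivalent.exists_covMatrix_eq {H : Digraph V} (hG : IsDAG G) (hH : IsDAG H)
    (e : MarkovEquivalent G H) (hΛ : Λ ∈ coeffMatrices G) (hω : ∀ i, 0 < ω i) :
    ∃ Γ ∈ coeffMatrices H, ∃ ν : V → ℝ, (∀ i, 0 < ν i) ∧ covMatrix Λ ω = covMatrix Γ ν := by
  refine MarkovEquivalent.induction (p := fun H => ∃ Γ ∈ coeffMatrices H, ∃ ν : V → ℝ,
    (∀ i, 0 < ν i) ∧ covMatrix Λ ω = covMatrix Γ ν) ?_ hG hH e ⟨Λ, hΛ, ω, hω, rfl⟩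
  rintro G x y hG hc ⟨Γ, hΓ, ν, hν, he⟩
  rw [he]
  exact hc.exists_covMatrix_eq hG hΓ hν

theorem model_subset {H : Digraph V} (P : Finpartition (Finset.univ : Finset V)) (hG : IsDAG G)
    (hH : IsDAG H) (e : MarkovEquivalent G H)
    (hp : ∀ B ∈ P.parts, 2 ≤ B.card → ∀ i ∈ B, parents G i = parents H i) :
    model G P ⊆ model H P := by
  rintro S ⟨Λ, hΛ, ω, hω, hP, rfl⟩
  obtain ⟨Γ, hΓ, ν, hν, he⟩ := e.exists_covMatrix_eq hG hH hΛ hω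
  refine ⟨Γ, hΓ, ν, hν, fun i j hij => ?_, he⟩
  rcases eq_or_ne i j with rfl | hne
  · rfl
  obtain ⟨B, hB, hi, hj⟩ := id hij
  have hc : 2 ≤ B.card := Finset.one_lt_card.2 ⟨i, hi, j, hj, hne⟩
  rw [← errorVariance_unique hG hH hΛ hΓ hω he (hp B hB hc i hi),
    ← errorVariance_unique hG hH hΛ hΓ hω he (hp B hB hc j hj), hP i j hij]

/-! ### Necessity: test covariances -/

/-- The covariance matrix when no vertex has both incoming and outgoing coefficients. -/
theorem covMatrix_of_sq_eq_zero (h : Λ * Λ = 0) :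
    covMatrix Λ (fun _ => 1) = 1 + Λ + Λᵀ + Λᵀ * Λ := by
  have : (1 - Λ)⁻¹ = 1 + Λ := by
    refine Matrix.inv_eq_right_inv ?_
    rw [sub_mul, mul_add, mul_add, h]
    simp
  rw [covMatrix, this, Matrix.diagonal_one, mul_one, Matrix.transpose_add, Matrix.transpose_one,
    add_mul, mul_add, mul_add]
  simp only [mul_one, one_mul]
  abel

theorem mem_model_of_mem_coeffMatrices (P : Finpartition (Finset.univ : Finset V))
    (hΛ : Λ ∈ coeffMatrices G) : covMatrix Λ (fun _ => 1) ∈ model G P :=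
  ⟨Λ, hΛ, fun _ => 1, fun _ => one_pos, fun _ _ _ => rfl, rfl⟩

omit [Fintype V] in
theorem single_mem_coeffMatrices {i j : V} (h : G.Adj i j) :
    Matrix.single i j (1 : ℝ) ∈ coeffMatrices G := by
  intro a b hab
  refine Matrix.single_apply_of_ne _ _ _ _ _ ?_
  rintro ⟨rfl, rfl⟩
  exact hab h

theorem covMatrix_single {i j : V} (h : i ≠ j) :
    covMatrix (Matrix.single i j (1 : ℝ)) (fun _ => 1) =
      1 + Matrix.single i j 1 + Matrix.single j i 1 + Matrix.single j j 1 := by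
  rw [covMatrix_of_sq_eq_zero (Matrix.single_mul_single_of_ne _ _ _ _ h.symm _),
    Matrix.transpose_single, Matrix.single_mul_single_same, mul_one]

/-- With the single coefficient `i → j`, only `i` and `j` are correlated. If `H` did not join them,
every vertex would be uncorrelated with its `H`-parents, forcing a diagonal covariance. -/
theorem adj_or_of_model_subset {H : Digraph V} (P : Finpartition (Finset.univ : Finset V))
    (hG : IsDAG G) (hH : IsDAG H) (h : model G P ⊆ model H P) {i j : V} (hij : G.Adj i j) :
    H.Adj i j ∨ H.Adj j i := by
  by_contra hno
  rw [not_or] at hno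
  have hne : i ≠ j := fun e => hG.irrefl j (e ▸ hij)
  obtain ⟨Γ, hΓ, ν, hν, -, he⟩ := h (mem_model_of_mem_coeffMatrices P (single_mem_coeffMatrices hij))
  rw [covMatrix_single hne] at he
  have hzero : Γ = 0 := by
    ext a b
    refine (coeff_eq_zero_of_uncorrelated hH hΓ hν (i := b) fun l hl => ?_).1 a
    rw [← he]
    have h₁ : l ≠ b := fun e => hH.irrefl b (e ▸ hl)
    have h₂ : ¬ (i = l ∧ j = b) := by rintro ⟨rfl, rfl⟩; exact hno.1 hl
    have h₃ : ¬ (j = l ∧ i = b) := by rintro ⟨rfl, rfl⟩; exact hno.2 hl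
    have h₄ : ¬ (j = l ∧ j = b) := by rintro ⟨rfl, rfl⟩; exact h₁ rfl
    simp [Matrix.one_apply_ne h₁, h₂, h₃, h₄]
  have := congrFun (congrFun he i) j
  simp [hzero, covMatrix, Matrix.one_apply_ne hne, hne, hne.symm] at this

/-- Unit coefficients `i → k ← j` give `i` and `j` a nonzero precision entry. As they are not
adjacent in `H`, it must come from a common child in `H`. -/
theorem collider_of_model_subset {H : Digraph V} (P : Finpartition (Finset.univ : Finset V))
    (hG : IsDAG G) (hH : IsDAG H) (h : model G P ⊆ model H P) {i j k : V} (hik : G.Adj i k)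
    (hjk : G.Adj j k) (hij : i ≠ j) (h₁ : ¬ H.Adj i j) (h₂ : ¬ H.Adj j i) :
    H.Adj i k ∧ H.Adj j k := by
  have hik' : i ≠ k := fun e => hG.irrefl k (e ▸ hik)
  have hjk' : j ≠ k := fun e => hG.irrefl k (e ▸ hjk)
  set Λ : Matrix V V ℝ := Matrix.single i k 1 + Matrix.single j k 1 with hΛdef
  have hΛ : Λ ∈ coeffMatrices G := fun a b hab => by
    rw [hΛdef, Matrix.add_apply, single_mem_coeffMatrices hik a b hab,
      single_mem_coeffMatrices hjk a b hab, add_zero]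
  have hsq : Λ * Λ = 0 := by
    simp [hΛdef, mul_add, add_mul, Matrix.single_mul_single_of_ne, hik'.symm, hjk'.symm]
  obtain ⟨Γ, hΓ, ν, hν, -, he⟩ := h (mem_model_of_mem_coeffMatrices P hΛ)
  have hS := he
  rw [covMatrix_of_sq_eq_zero hsq] at hS
  -- Such a `b` is uncorrelated with all other vertices, so it cannot be the common child.
  have hcol : ∀ b, b ≠ i → b ≠ j → b ≠ k → ∀ a, Γ a b = 0 := by
    intro b hbi hbj hbk
    refine (coeff_eq_zero_of_uncorrelated hH hΓ hν fun l hl => ?_).1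
    have hlb : l ≠ b := fun e => hH.irrefl b (e ▸ hl)
    rw [← hS]
    simp [hΛdef, mul_add, add_mul, Matrix.single_mul_single_of_ne, hij, hij.symm, hlb,
      hbi.symm, hbj.symm, hbk.symm]
  have hK : precMatrix Γ ν i j = 1 := by
    rw [← inv_covMatrix hH hΓ hν, ← he, inv_covMatrix hG hΛ (fun _ => one_pos), precMatrix]
    simp [hΛdef, mul_add, add_mul, mul_sub, sub_mul, hij, hij.symm,
      hik'.symm, hjk'.symm]
  rw [precMatrix_apply] at hK
  obtain ⟨l, -, hl⟩ := Finset.exists_ne_zero_of_sum_ne_zero (hK.trans_ne one_ne_zero)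
  have hli : i ≠ l := by
    rintro rfl
    simp [hΓ _ _ h₂, hij.symm] at hl
  have hlj : j ≠ l := by
    rintro rfl
    simp [hΓ _ _ h₁, hij] at hl
  have hil : Γ i l ≠ 0 := fun e => by simp [e, hli] at hl
  have hjl : Γ j l ≠ 0 := fun e => by simp [e, hlj] at hl
  have hlk : l = k := by
    by_contra hlk
    exact hil (hcol l hli.symm hlj.symm hlk i)
  subst hlk
  exact ⟨by_contra fun e => hil (hΓ _ _ e), by_contra fun e => hjl (hΓ _ _ e)⟩

/-- With the single coefficient `j → i`, vertex `i` has variance 2 and all others 1. If `j` were not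
an `H`-parent, `i` would have error variance 2 in `H`, exceeding the variance of a blockmate that
must share it. -/
theorem adj_of_model_subset {H : Digraph V} (P : Finpartition (Finset.univ : Finset V))
    (hG : IsDAG G) (hH : IsDAG H) (h : model G P ⊆ model H P) {B : Finset V} (hB : B ∈ P.parts)
    (hc : 2 ≤ B.card) {i j : V} (hi : i ∈ B) (hji : G.Adj j i) : H.Adj j i := by
  by_contra hno
  have hne : j ≠ i := fun e => hG.irrefl i (e ▸ hji)
  obtain ⟨i', hi', hii'⟩ := Finset.exists_mem_ne hc i
  obtain ⟨Γ, hΓ, ν, hν, hP, he⟩ :=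
    h (mem_model_of_mem_coeffMatrices P (single_mem_coeffMatrices hji))
  rw [covMatrix_single hne] at he
  have hνi := (coeff_eq_zero_of_uncorrelated hH hΓ hν (i := i) fun l hl => by
    have h₁ : l ≠ i := fun e => hH.irrefl i (e ▸ hl)
    have h₂ : j ≠ l := by rintro rfl; exact hno hl
    rw [← he]
    simp [h₁, h₁.symm, h₂, hne]).2
  have hνi' := le_covMatrix_self hH hΓ hν i'
  rw [← hP i i' ⟨B, hB, hi, hi'⟩, hνi, ← he] at hνi'
  simp [hne, hii'.symm] at hνi'
  norm_num at hνi'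

theorem skeleton_colliders_eq_of_model_eq {H : Digraph V} (P : Finpartition (Finset.univ : Finset V))
    (hG : IsDAG G) (hH : IsDAG H) (h : model G P = model H P) :
    skeleton G = skeleton H ∧ unshieldedColliders G = unshieldedColliders H := by
  have hs : ∀ a b, (G.Adj a b ∨ G.Adj b a) ↔ (H.Adj a b ∨ H.Adj b a) := fun a b =>
    ⟨fun h' => h'.elim (adj_or_of_model_subset P hG hH h.subset)
      fun h' => (adj_or_of_model_subset P hG hH h.subset h').symm,
    fun h' => h'.elim (adj_or_of_model_subset P hH hG h.superset)
      fun h' => (adj_or_of_model_subset P hH hG h.superset h').symm⟩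
  refine ⟨(skeleton_eq_iff hG hH).2 hs, ?_⟩
  ext ⟨i, k, j⟩
  have hs' := hs i j
  simp only [unshieldedColliders, Set.mem_ofPred_eq]
  constructor
  · rintro ⟨h₁, h₂, h₃, h₄, h₅⟩
    have h₄' : ¬ H.Adj i j := by tauto
    have h₅' : ¬ H.Adj j i := by tauto
    obtain ⟨h₆, h₇⟩ := collider_of_model_subset P hG hH h.subset h₁ h₂ h₃ h₄' h₅'
    exact ⟨h₆, h₇, h₃, h₄', h₅'⟩
  · rintro ⟨h₁, h₂, h₃, h₄, h₅⟩
    have h₄' : ¬ G.Adj i j := by tauto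
    have h₅' : ¬ G.Adj j i := by tauto
    obtain ⟨h₆, h₇⟩ := collider_of_model_subset P hH hG h.superset h₁ h₂ h₃ h₄' h₅'
    exact ⟨h₆, h₇, h₃, h₄', h₅'⟩

end Linear

end PartialHomoscedastic

theorem theorem4p2 {V : Type*} [Fintype V] [DecidableEq V] (G₁ G₂ : Digraph V)
    (hG₁ : PartialHomoscedastic.IsDAG G₁) (hG₂ : PartialHomoscedastic.IsDAG G₂)
    (P : Finpartition (Finset.univ : Finset V)) :
    PartialHomoscedastic.ModelEquivalent P G₁ G₂ ↔
      (PartialHomoscedastic.skeleton G₁ = PartialHomoscedastic.skeleton G₂ ∧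
        PartialHomoscedastic.unshieldedColliders G₁ =
          PartialHomoscedastic.unshieldedColliders G₂) ∧
      ∀ B ∈ P.parts, 2 ≤ B.card → ∀ i ∈ B,
        PartialHomoscedastic.parents G₁ i = PartialHomoscedastic.parents G₂ i := by
  constructor
  · intro h
    refine ⟨PartialHomoscedastic.skeleton_colliders_eq_of_model_eq P hG₁ hG₂ h, fun B hB hc i hi => ?_⟩
    ext j
    exact ⟨PartialHomoscedastic.adj_of_model_subset P hG₁ hG₂ (Eq.subset h) hB hc hi,
      PartialHomoscedastic.adj_of_model_subset P hG₂ hG₁ (Eq.superset h) hB hc hi⟩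
  · rintro ⟨⟨hs, hc⟩, hp⟩
    refine Set.Subset.antisymm
      (PartialHomoscedastic.model_subset P hG₁ hG₂
        (PartialHomoscedastic.markovEquivalent_of_eq hG₁ hG₂ hs hc) hp)
      (PartialHomoscedastic.model_subset P hG₂ hG₁
        (PartialHomoscedastic.markovEquivalent_of_eq hG₂ hG₁ hs.symm hc.symm)
        fun B hB h2 i hi => (hp B hB h2 i hi).symm)
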